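/- Let $d\ge 1$ and $k\ge 1$ be integers and let $\alpha>d$ be real. Let $s_{d-1}$ be the surface area of the unit sphere of $\mathbb R^d$, let $C_k=\dfrac{s_{d-1}}{(k+2)!\,(\alpha(k+2)-d)}$, and let $\lambda_k$ be the Lebesgue measure on $(\mathbb R^d)^{k+1}$. Let $B(x;t)$ be the closed ball of radius $t$ about $x\in\mathbb R^d$. For $t\ge 0$ and $x_1,\dots,x_{k+2}\in\mathbb R^d$ put $$h_t^+(x_1,\dots,x_{k+2})=\mathbf 1\Bigl\{\bigcap_{j\ne j_0}B(x_j;t)\ne\emptyset\ \text{for all } j_0\in\{1,\dots,k+2\}\Bigr\},\qquad h_t^-(x_1,\dots,x_{k+2})=\mathbf 1\Bigl\{\bigcap_{j=1}^{k+2}B(x_j;t)\ne\emptyset\Bigr\},$$ and $h^\pm=h_1^\pm$. Let $G_k$ be a Gaussian $C_k\lambda_k$-noise on a probability space: a family of random variables $G_k(A)$, indexed by the measurable sets $A\subset(\mathbb R^d)^{k+1}$ with $\lambda_k(A)<\infty$, such that $G_k(A)\sim\mathcal N(0,C_k\lambda_k(A))$; $G_k(A\cup B)=G_k(A)+G_k(B)$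 almost surely if $A\cap B=\emptyset$; and $G_k(A_1),\dots,G_k(A_n)$ are independent if $A_1,\dots,A_n$ are pairwise disjoint. For $f\in L^2(C_k\lambda_k)$ the stochastic integral $\int f\,dG_k$ is the $L^2$-limit of the integrals $\sum_c c\,G_k(\{s_n=c\})$ (sum over the non-zero values $c$ of $s_n$) of simple functions $s_n\to f$ in $L^2(C_k\lambda_k)$. Then, for each of the two signs, $h^\pm(0,\cdot)$ is integrable on $(\mathbb R^d)^{k+1}$, so that $D_k^\pm:=C_k\int_{(\mathbb R^d)^{k+1}}h^\pm(0,\mathbf y)\,d\mathbf y$ is finite; the integral $Y_k^\pm(t)=\int_{(\mathbb R^d)^{k+1}}h_t^\pm(0,\mathbf y)\,G_k(d\mathbf y)$ exists for every $t\ge 0$; and, for any choice of versions of these integrals and any standard Brownian motion $B^\pm$ (on any probability space), $$\bigl(Y_k^\pm(t),\ t\ge 0\bigr)\ \stackrel{d}{=}\ \Bigl(B^\pm\bigl(D_k^\pm\,t^{d(k+1)}\bigr),\ t\ge 0\Bigr)$$ in the sense that all finite-dimensional distributions of the two processes agree. -/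

import Mathlib

open MeasureTheory ProbabilityTheory Filter Topology
open scoped NNReal ENNReal Nat

noncomputable section

/-- The event `⋂_{j ≠ j₀} B(x_j; t) ≠ ∅` for all `j₀`, for `m` points of `ℝ^d` (closed balls). -/
def almostAllBallsMeet (d m : ℕ) (t : ℝ) : Set (Fin m → EuclideanSpace ℝ (Fin d)) :=
  {x | ∀ j₀, (⋂ j, ⋂ (_ : j ≠ j₀), Metric.closedBall (x j) t).Nonempty}

/-- The event `⋂_j B(x_j; t) ≠ ∅` for `m` points of `ℝ^d` (closed balls). -/
def allBallsMeet (d m : ℕ) (t : ℝ) : Set (Fin m → EuclideanSpace ℝ (Fin d)) :=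
  {x | (⋂ j, Metric.closedBall (x j) t).Nonempty}

/-- The indicator function `h_t⁺(x_1, …, x_{k+2})`. -/
def hPlus (d k : ℕ) (t : ℝ) (x : Fin (k + 2) → EuclideanSpace ℝ (Fin d)) : ℝ :=
  (almostAllBallsMeet d (k + 2) t).indicator 1 x

/-- The indicator function `h_t⁻(x_1, …, x_{k+2})`. -/
def hMinus (d k : ℕ) (t : ℝ) (x : Fin (k + 2) → EuclideanSpace ℝ (Fin d)) : ℝ :=
  (allBallsMeet d (k + 2) t).indicator 1 x

/-- `y ↦ h_t⁺(0, y)` on `(ℝ^d)^{k+1}`. -/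
def hPlusZero (d k : ℕ) (t : ℝ) (y : Fin (k + 1) → EuclideanSpace ℝ (Fin d)) : ℝ :=
  hPlus d k t (Fin.cons 0 y)

/-- `y ↦ h_t⁻(0, y)` on `(ℝ^d)^{k+1}`. -/
def hMinusZero (d k : ℕ) (t : ℝ) (y : Fin (k + 1) → EuclideanSpace ℝ (Fin d)) : ℝ :=
  hMinus d k t (Fin.cons 0 y)

/-- The surface area `s_{d-1}` of the unit sphere of `ℝ^d`. -/
def sphereArea (d : ℕ) : ℝ :=
  (volume : Measure (EuclideanSpace ℝ (Fin d))).toSphere.real Set.univ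

/-- The constant `C_k = s_{d-1} / ((k+2)! (α (k+2) - d))`. -/
def constC (d k : ℕ) (α : ℝ) : ℝ :=
  sphereArea d / (((k + 2)! : ℝ) * (α * ((k : ℝ) + 2) - (d : ℝ)))

/-- The measure `C_k λ_k` on `(ℝ^d)^{k+1}`, with `λ_k` the Lebesgue measure. -/
def controlMeasure (d k : ℕ) (α : ℝ) : Measure (Fin (k + 1) → EuclideanSpace ℝ (Fin d)) :=
  ENNReal.ofReal (constC d k α) • volume

/-- The constant `D_k⁺ = C_k ∫ h⁺(0, y) dy`, where `h⁺ = h_1⁺`. -/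
def constDPlus (d k : ℕ) (α : ℝ) : ℝ :=
  constC d k α * ∫ y, hPlusZero d k 1 y

/-- The constant `D_k⁻ = C_k ∫ h⁻(0, y) dy`, where `h⁻ = h_1⁻`. -/
def constDMinus (d k : ℕ) (α : ℝ) : ℝ :=
  constC d k α * ∫ y, hMinusZero d k 1 y

/-- `G` is a Gaussian `μ`-noise on the probability space `(Ω, P)`: a random set function, whose
values matter only at measurable sets of finite `μ`-measure, that is centred Gaussian with variance
`μ A`, almost surely additive on disjoint sets, and independently scattered. -/
structure IsGaussianNoise {E Ω : Type*} [MeasurableSpace E] [MeasurableSpace Ω]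
    (G : Set E → Ω → ℝ) (μ : Measure E) (P : Measure Ω) : Prop where
  hasLaw : ∀ A, MeasurableSet A → μ A < ∞ → HasLaw (G A) (gaussianReal 0 (μ A).toNNReal) P
  additive : ∀ A B, MeasurableSet A → μ A < ∞ → MeasurableSet B → μ B < ∞ → Disjoint A B →
    G (A ∪ B) =ᵐ[P] G A + G B
  indep : ∀ (n : ℕ) (A : Fin n → Set E), (∀ i, MeasurableSet (A i) ∧ μ (A i) < ∞) →
    Pairwise (fun i j => Disjoint (A i) (A j)) → iIndepFun (fun i => G (A i)) P

/-- The integral `∑_c c · G(s = c)` of a simple function (the value `c = 0` contributes `0`). -/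
def simpleNoiseIntegral {E Ω : Type*} [MeasurableSpace E]
    (G : Set E → Ω → ℝ) (s : SimpleFunc E ℝ) (ω : Ω) : ℝ :=
  ∑ c ∈ s.range, c * G (s ⁻¹' {c}) ω

/-- `I` is (a version of) the stochastic integral `∫ f dG` of `f ∈ L²(μ)` against the Gaussian
`μ`-noise `G`: the `L²(P)`-limit of the integrals of simple functions that tend to `f` in
`L²(μ)`. -/
def IsNoiseIntegral {E Ω : Type*} [MeasurableSpace E] [MeasurableSpace Ω]
    (G : Set E → Ω → ℝ) (μ : Measure E) (P : Measure Ω) (f : E → ℝ) (I : Ω → ℝ) : Prop :=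
  MemLp f 2 μ ∧ MemLp I 2 P ∧
    ∃ s : ℕ → SimpleFunc E ℝ, (∀ n, MemLp (s n) 2 μ) ∧
      Tendsto (fun n => eLpNorm (fun y => s n y - f y) 2 μ) atTop (𝓝 0) ∧
      Tendsto (fun n => eLpNorm (fun ω => simpleNoiseIntegral G (s n) ω - I ω) 2 P) atTop (𝓝 0)

/-- Equality in law of two real processes, possibly on different probability spaces: all their
finite-dimensional distributions agree. -/
def EqualInLaw {T Ω Ω' : Type*} [MeasurableSpace Ω] [MeasurableSpace Ω']
    (X : T → Ω → ℝ) (P : Measure Ω) (X' : T → Ω' → ℝ) (P' : Measure Ω') : Prop :=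
  ∀ I : Finset T, IdentDistrib (fun ω => I.restrict (X · ω)) (fun ω => I.restrict (X' · ω)) P P'

end

open scoped Pointwise

/-! Let `A t` be the set of `y` for which the configuration `(0, y)` satisfies the ball condition at
radius `t`. The integral of its indicator is almost surely `G (A t)`, so the process is the noise
evaluated along an increasing family of sets.

Such a process is centred Gaussian. For `s ≤ t`, `G (A t)` is `G (A s)` plus an independent term, so
the covariance is the smaller of the two measures, as for Brownian motion run at the clock `t ↦ μ (A
t)` (`IsGaussianNoise.equalInLaw_of_monotone`). The ball condition is homogeneous, hence `A t = t •
A 1` (`IsRadiusFamily.zero_section_eq_smul`), and Lebesgue scaling in dimension `d (k + 1)` turns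
the clock into a constant times `t ^ (d * (k + 1))`. -/

lemma StrongDual.apply_eq_sum_single {ι : Type*} [Fintype ι] [DecidableEq ι]
    (L : StrongDual ℝ (ι → ℝ)) (x : ι → ℝ) : L x = ∑ i, L (Pi.single i 1) * x i := by
  rw [← L.sum_comp_single]
  refine Finset.sum_congr rfl fun i _ => ?_
  have : (Pi.single i (x i) : ι → ℝ) = x i • Pi.single i 1 := by
    rw [← Pi.single_smul', smul_eq_mul, mul_one]
  simp [this, mul_comm]

/-- The zero level set may have infinite measure, where nothing is known about `G`; its coefficient
removes it. -/
lemma simpleNoiseIntegral_eq_sum_ne_zero {E Ω : Type*} [MeasurableSpace E]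
    (G : Set E → Ω → ℝ) (s : SimpleFunc E ℝ) :
    simpleNoiseIntegral G s = ∑ c : s.range.filter (· ≠ 0), (c : ℝ) • G (s ⁻¹' {(c : ℝ)}) := by
  ext ω
  rw [simpleNoiseIntegral, Finset.sum_apply, Finset.sum_coe_sort (s.range.filter (· ≠ 0))
    (fun c => (c • G (s ⁻¹' {c})) ω), Finset.sum_filter]
  exact Finset.sum_congr rfl fun c _ => by by_cases hc : c = 0 <;> simp [hc]

/-! ### Integrals of simple functions against a Gaussian noise. -/

namespace IsGaussianNoise

variable {E Ω : Type*} [MeasurableSpace E] [MeasurableSpace Ω]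
  {G : Set E → Ω → ℝ} {μ : Measure E} {P : Measure Ω}

lemma hasGaussianLaw (hG : IsGaussianNoise G μ P) {A : Set E} (hA : MeasurableSet A)
    (hμA : μ A < ∞) : HasGaussianLaw (G A) P :=
  (hG.hasLaw A hA hμA).hasGaussianLaw

lemma integral_eq_zero (hG : IsGaussianNoise G μ P) {A : Set E} (hA : MeasurableSet A)
    (hμA : μ A < ∞) : ∫ ω, G A ω ∂P = 0 := by
  rw [(hG.hasLaw A hA hμA).integral_eq, integral_id_gaussianReal]

lemma variance_eq (hG : IsGaussianNoise G μ P) {A : Set E} (hA : MeasurableSet A)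
    (hμA : μ A < ∞) : Var[G A; P] = μ.real A := by
  rw [(hG.hasLaw A hA hμA).variance_eq, variance_id_gaussianReal]
  rfl

lemma empty_ae_eq_zero (hG : IsGaussianNoise G μ P) : G ∅ =ᵐ[P] 0 := by
  have h := hG.hasLaw ∅ MeasurableSet.empty (by simp)
  rw [measure_empty, ENNReal.toNNReal_zero, gaussianReal_zero_var] at h
  exact h.ae_eq_of_dirac

lemma biUnion_ae_eq_sum (hG : IsGaussianNoise G μ P) {ι : Type*} (S : Finset ι) (A : ι → Set E)
    (hA : ∀ i ∈ S, MeasurableSet (A i)) (hμA : ∀ i ∈ S, μ (A i) < ∞)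
    (hd : (S : Set ι).PairwiseDisjoint A) :
    G (⋃ i ∈ S, A i) =ᵐ[P] ∑ i ∈ S, G (A i) := by
  classical
  induction S using Finset.induction_on with
  | empty => simpa using hG.empty_ae_eq_zero
  | insert a S ha ih =>
    rw [Finset.set_biUnion_insert, Finset.sum_insert ha]
    have hS : ∀ i ∈ S, i ∈ insert a S := fun i hi => Finset.mem_insert_of_mem hi
    have haS : a ∈ insert a S := Finset.mem_insert_self a S
    refine (hG.additive _ _ (hA a haS) (hμA a haS)
      (S.measurableSet_biUnion fun i hi => hA i (hS i hi))
      (measure_biUnion_lt_top S.finite_toSet fun i hi => hμA i (hS i hi)) ?_).trans ?_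
    · rw [Set.disjoint_iUnion₂_right]
      intro i hi
      exact hd (by simp) (by simp [hi]) fun h => ha (h ▸ hi)
    · exact EventuallyEq.rfl.add (ih (fun i hi => hA i (hS i hi)) (fun i hi => hμA i (hS i hi))
        (hd.subset (by simp)))

/-- A level set with a nonzero value may be cut into finitely many pieces without changing the
stochastic integral. -/
lemma simpleNoiseIntegral_map (hG : IsGaussianNoise G μ P) {β : Type*} (g : SimpleFunc E β)
    (f : β → ℝ) (hf : ∀ b, f b ≠ 0 → μ (g ⁻¹' {b}) < ∞) :
    simpleNoiseIntegral G (g.map f) =ᵐ[P] fun ω => ∑ b ∈ g.range, f b * G (g ⁻¹' {b}) ω := by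
  classical
  have key : ∀ c ∈ (g.map f).range, ∀ᵐ ω ∂P,
      c * G (g.map f ⁻¹' {c}) ω = ∑ b ∈ g.range with f b = c, f b * G (g ⁻¹' {b}) ω := by
    intro c _
    -- For `c = 0` the pieces may have infinite measure, so additivity is unavailable, but every
    -- coefficient is zero.
    rcases eq_or_ne c 0 with rfl | hc
    · refine .of_forall fun ω => ?_
      rw [zero_mul, Finset.sum_eq_zero]
      intro b hb
      rw [(Finset.mem_filter.1 hb).2, zero_mul]
    have h := hG.biUnion_ae_eq_sum (g.range.filter fun b => f b = c) (fun b => g ⁻¹' {b})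
      (fun b _ => g.measurableSet_fiber b)
      (fun b hb => hf b ((Finset.mem_filter.1 hb).2 ▸ hc))
      (fun b _ b' _ hbb => (Set.disjoint_singleton.2 hbb).preimage g)
    have hU : g.map f ⁻¹' {c} = ⋃ b ∈ g.range.filter (fun b => f b = c), g ⁻¹' {b} := by
      rw [SimpleFunc.map_preimage_singleton]
      ext x
      simp
    filter_upwards [h] with ω hω
    rw [hU, hω, Finset.sum_apply, Finset.mul_sum]
    exact Finset.sum_congr rfl fun b hb => by rw [(Finset.mem_filter.1 hb).2]
  filter_upwards [(ae_ball_iff (Finset.countable_toSet _)).2 key] with ω hω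
  rw [simpleNoiseIntegral, Finset.sum_congr rfl hω]
  refine Finset.sum_fiberwise_of_maps_to (fun b hb => ?_) _
  rw [SimpleFunc.range_map]
  exact Finset.mem_image_of_mem f hb

/-- All three integrals are expanded over the common refinement given by the level sets of the pair
`(s, s')`; there the identity holds term by term. -/
lemma simpleNoiseIntegral_linear (hG : IsGaussianNoise G μ P) {s s' : SimpleFunc E ℝ}
    (hs : MemLp s 2 μ) (hs' : MemLp s' 2 μ) (a b : ℝ) :
    simpleNoiseIntegral G (a • s + b • s') =ᵐ[P]
      fun ω => a * simpleNoiseIntegral G s ω + b * simpleNoiseIntegral G s' ω := by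
  have hfin : ∀ p : ℝ × ℝ, p ≠ 0 → μ (s.pair s' ⁻¹' {p}) < ∞ := by
    rintro ⟨x, y⟩ hp
    rw [SimpleFunc.pair_preimage_singleton]
    by_cases hx : x = 0
    · have hy : y ≠ 0 := fun hy => hp (by simp [hx, hy])
      exact (measure_mono Set.inter_subset_right).trans_lt
        (s'.measure_preimage_lt_top_of_memLp two_ne_zero (by simp) hs' y hy)
    · exact (measure_mono Set.inter_subset_left).trans_lt
        (s.measure_preimage_lt_top_of_memLp two_ne_zero (by simp) hs x hx)
  have h (f : ℝ × ℝ → ℝ) (hf : f 0 = 0) := hG.simpleNoiseIntegral_map (s.pair s') f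
    fun p hp => hfin p fun h0 => hp (h0 ▸ hf)
  have h1 := h (fun p => a * p.1 + b * p.2) (by simp)
  have h2 := h Prod.fst rfl
  have h3 := h Prod.snd rfl
  have e1 : (s.pair s').map (fun p => a * p.1 + b * p.2) = a • s + b • s' := by ext; simp
  have e2 : (s.pair s').map Prod.fst = s := by ext; simp
  have e3 : (s.pair s').map Prod.snd = s' := by ext; simp
  rw [e1] at h1
  rw [e2] at h2
  rw [e3] at h3
  filter_upwards [h1, h2, h3] with ω h1 h2 h3
  rw [h1, h2, h3, Finset.mul_sum, Finset.mul_sum, ← Finset.sum_add_distrib]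
  exact Finset.sum_congr rfl fun _ _ => by ring

lemma iIndepFun_smul_fiber (hG : IsGaussianNoise G μ P) {s : SimpleFunc E ℝ} (hs : MemLp s 2 μ) :
    iIndepFun (fun c : s.range.filter (· ≠ 0) => (c : ℝ) • G (s ⁻¹' {(c : ℝ)})) P := by
  let e := (s.range.filter (· ≠ 0)).equivFin
  have h := hG.indep _ (fun i => s ⁻¹' {(e.symm i : ℝ)})
    (fun i => ⟨s.measurableSet_fiber _, s.measure_preimage_lt_top_of_memLp two_ne_zero (by simp) hs
      _ (Finset.mem_filter.1 (e.symm i).2).2⟩)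
    (fun i j hij => (Set.disjoint_singleton.2 fun h => hij
      (e.symm.injective (Subtype.ext h))).preimage s)
  have h' := (h.precomp e.injective).comp (fun c x => (c : ℝ) * x)
    (fun c => measurable_const_mul _)
  convert h' using 2 with c
  ext ω
  simp

lemma measure_fiber_lt_top {s : SimpleFunc E ℝ} (hs : MemLp s 2 μ)
    (c : s.range.filter (· ≠ 0)) : μ (s ⁻¹' {(c : ℝ)}) < ∞ :=
  s.measure_preimage_lt_top_of_memLp two_ne_zero (by simp) hs _ (Finset.mem_filter.1 c.2).2

lemma hasGaussianLaw_simpleNoiseIntegral (hG : IsGaussianNoise G μ P) {s : SimpleFunc E ℝ}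
    (hs : MemLp s 2 μ) : HasGaussianLaw (simpleNoiseIntegral G s) P := by
  rw [simpleNoiseIntegral_eq_sum_ne_zero]
  exact ((hG.iIndepFun_smul_fiber hs).hasGaussianLaw fun c =>
    (hG.hasGaussianLaw (s.measurableSet_fiber _) (measure_fiber_lt_top hs c)).smul _).sum

lemma integral_simpleNoiseIntegral (hG : IsGaussianNoise G μ P) {s : SimpleFunc E ℝ}
    (hs : MemLp s 2 μ) : ∫ ω, simpleNoiseIntegral G s ω ∂P = 0 := by
  simp_rw [simpleNoiseIntegral_eq_sum_ne_zero, Finset.sum_apply, Pi.smul_apply]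
  rw [integral_finsetSum]
  · refine Finset.sum_eq_zero fun c _ => ?_
    rw [integral_smul, hG.integral_eq_zero (s.measurableSet_fiber _) (measure_fiber_lt_top hs c),
      smul_zero]
  · exact fun c _ => (hG.hasGaussianLaw (s.measurableSet_fiber _)
      (measure_fiber_lt_top hs c)).integrable.smul (c : ℝ)

lemma variance_simpleNoiseIntegral (hG : IsGaussianNoise G μ P) {s : SimpleFunc E ℝ}
    (hs : MemLp s 2 μ) : Var[simpleNoiseIntegral G s; P] = ∫ x, s x ^ 2 ∂μ := by
  have hint : Integrable s μ := SimpleFunc.integrable_iff.2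
    ((SimpleFunc.memLp_iff two_ne_zero (by simp)).1 hs)
  have hsq : Integrable (s.map (· ^ 2)) μ := hs.integrable_sq
  have h1 : ∫ x, s x ^ 2 ∂μ = (s.map (· ^ 2)).integral μ :=
    (SimpleFunc.integral_eq_integral _ hsq).symm
  rw [simpleNoiseIntegral_eq_sum_ne_zero, IndepFun.variance_sum, h1,
    SimpleFunc.map_integral s _ hint (by simp)]
  · have hvar : ∀ c : s.range.filter (· ≠ 0), Var[(c : ℝ) • G (s ⁻¹' {(c : ℝ)}); P] =
        μ.real (s ⁻¹' {(c : ℝ)}) • (c : ℝ) ^ 2 := fun c => by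
      rw [variance_smul, hG.variance_eq (s.measurableSet_fiber _) (measure_fiber_lt_top hs c),
        smul_eq_mul, mul_comm]
    rw [Finset.sum_congr rfl fun c _ => hvar c,
      Finset.sum_coe_sort (s.range.filter (· ≠ 0)) (fun c => μ.real (s ⁻¹' {c}) • c ^ 2),
      Finset.sum_filter]
    exact Finset.sum_congr rfl fun c _ => by by_cases hc : c = 0 <;> simp [hc]
  · exact fun c _ => ((hG.hasGaussianLaw (s.measurableSet_fiber _)
      (measure_fiber_lt_top hs c)).smul _).memLp_two
  · exact fun c _ c' _ hcc => (hG.iIndepFun_smul_fiber hs).indepFun hcc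

/-- Itô isometry: the mean is zero, so the second moment is the variance, which adds up over the
independent level-set terms. -/
lemma eLpNorm_simpleNoiseIntegral (hG : IsGaussianNoise G μ P) {s : SimpleFunc E ℝ}
    (hs : MemLp s 2 μ) : eLpNorm (simpleNoiseIntegral G s) 2 P = eLpNorm s 2 μ := by
  have hJ := (hG.hasGaussianLaw_simpleNoiseIntegral hs).memLp_two
  have hvar := hG.variance_simpleNoiseIntegral hs
  rw [variance_of_integral_eq_zero hJ.aemeasurable (hG.integral_simpleNoiseIntegral hs)] at hvar
  rw [hJ.eLpNorm_eq_integral_rpow_norm two_ne_zero (by simp),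
    hs.eLpNorm_eq_integral_rpow_norm two_ne_zero (by simp)]
  simp [hvar]

lemma simpleNoiseIntegral_ae_eq_of_level_one (hG : IsGaussianNoise G μ P) {s : SimpleFunc E ℝ}
    (hs : s.range ⊆ {0, 1}) : simpleNoiseIntegral G s =ᵐ[P] G (s ⁻¹' {1}) := by
  filter_upwards [hG.empty_ae_eq_zero] with ω hω
  -- A value in `{0, 1}` that `s` does not take has an empty fibre, where `G` vanishes almost
  -- surely.
  rw [simpleNoiseIntegral, Finset.sum_subset hs]
  · simp
  · intro c _ hc
    rw [(s.preimage_eq_empty_iff c).2 (by simpa using hc), hω]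
    simp

end IsGaussianNoise

/-! ### Integrals of indicators, joint Gaussianity and covariance of the noise. -/

/-- The indicator function of a measurable set as a simple function. -/
noncomputable def indicatorSimpleFunc {E : Type*} [MeasurableSpace E] (A : Set E)
    (hA : MeasurableSet A) : SimpleFunc E ℝ :=
  SimpleFunc.piecewise A hA (SimpleFunc.const E 1) (SimpleFunc.const E 0)

lemma coe_indicatorSimpleFunc {E : Type*} [MeasurableSpace E] (A : Set E)
    (hA : MeasurableSet A) : ⇑(indicatorSimpleFunc A hA) = A.indicator 1 := by
  ext x
  by_cases hx : x ∈ A <;> simp [indicatorSimpleFunc, hx]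

lemma memLp_indicatorSimpleFunc {E : Type*} [MeasurableSpace E] {μ : Measure E} (A : Set E)
    (hA : MeasurableSet A) (hμA : μ A < ∞) : MemLp (indicatorSimpleFunc A hA) 2 μ := by
  rw [coe_indicatorSimpleFunc]
  exact memLp_indicator_const 2 hA (1 : ℝ) (Or.inr hμA.ne)

namespace IsGaussianNoise

variable {E Ω : Type*} [MeasurableSpace E] [MeasurableSpace Ω]
  {G : Set E → Ω → ℝ} {μ : Measure E} {P : Measure Ω}

lemma simpleNoiseIntegral_indicatorSimpleFunc (hG : IsGaussianNoise G μ P) {A : Set E}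
    (hA : MeasurableSet A) : simpleNoiseIntegral G (indicatorSimpleFunc A hA) =ᵐ[P] G A := by
  have hpre : indicatorSimpleFunc A hA ⁻¹' {1} = A := by
    ext x
    by_cases hx : x ∈ A <;> simp [coe_indicatorSimpleFunc, hx]
  have h := hG.simpleNoiseIntegral_ae_eq_of_level_one (s := indicatorSimpleFunc A hA) ?_
  · rwa [hpre] at h
  · intro c hc
    obtain ⟨x, rfl⟩ := SimpleFunc.mem_range.1 hc
    by_cases hx : x ∈ A <;> simp [coe_indicatorSimpleFunc, hx]

lemma isNoiseIntegral_indicator (hG : IsGaussianNoise G μ P) {A : Set E}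
    (hA : MeasurableSet A) (hμA : μ A < ∞) : IsNoiseIntegral G μ P (A.indicator 1) (G A) := by
  have hmem := memLp_indicatorSimpleFunc A hA hμA
  refine ⟨coe_indicatorSimpleFunc A hA ▸ hmem, (hG.hasGaussianLaw hA hμA).memLp_two,
    fun _ => indicatorSimpleFunc A hA, fun _ => hmem, ?_, ?_⟩
  · simp [coe_indicatorSimpleFunc]
  · refine tendsto_const_nhds.congr fun _ =>
      ((eLpNorm_congr_ae (g := 0) ?_).trans eLpNorm_zero).symm
    · filter_upwards [hG.simpleNoiseIntegral_indicatorSimpleFunc hA] with ω hω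
      simp [hω]

/-- By linearity and the isometry, the integrals of the approximating `s n` converge in `L²(P)` to
`G A`; they also converge to `I`, and limits are unique. -/
lemma ae_eq_of_isNoiseIntegral_indicator (hG : IsGaussianNoise G μ P) {A : Set E}
    (hA : MeasurableSet A) (hμA : μ A < ∞) {I : Ω → ℝ}
    (hI : IsNoiseIntegral G μ P (A.indicator 1) I) : I =ᵐ[P] G A := by
  obtain ⟨-, hI2, s, hs, hsA, hsI⟩ := hI
  have hmem := memLp_indicatorSimpleFunc A hA hμA
  have hGA := (hG.hasGaussianLaw hA hμA).memLp_two
  have hsG : Tendsto (fun n => eLpNorm (fun ω => simpleNoiseIntegral G (s n) ω - G A ω) 2 P)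
      atTop (𝓝 0) := by
    refine hsA.congr fun n => ?_
    have hlin := hG.simpleNoiseIntegral_linear (hs n) hmem 1 (-1)
    have hmem' : MemLp ((1 : ℝ) • s n + (-1 : ℝ) • indicatorSimpleFunc A hA : SimpleFunc E ℝ) 2 μ :=
      ((hs n).const_smul 1).add (hmem.const_smul (-1))
    have hiso := hG.eLpNorm_simpleNoiseIntegral hmem'
    rw [eLpNorm_congr_ae hlin] at hiso
    have e1 : (fun y => s n y - A.indicator 1 y) =
        ⇑((1 : ℝ) • s n + (-1 : ℝ) • indicatorSimpleFunc A hA : SimpleFunc E ℝ) := by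
      ext y
      simp [coe_indicatorSimpleFunc, sub_eq_add_neg]
    rw [e1, ← hiso]
    refine eLpNorm_congr_ae ?_
    filter_upwards [hG.simpleNoiseIntegral_indicatorSimpleFunc hA] with ω hω
    rw [hω]
    ring
  have hzero : eLpNorm (I - G A) 2 P = 0 := by
    have hsum := hsG.add hsI
    rw [add_zero] at hsum
    refine le_antisymm (ge_of_tendsto' hsum fun n => ?_) zero_le
    have hJ := (hG.hasGaussianLaw_simpleNoiseIntegral (hs n)).memLp_two
    have hsub : I - G A = (fun ω => simpleNoiseIntegral G (s n) ω - G A ω) -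
        fun ω => simpleNoiseIntegral G (s n) ω - I ω := by
      ext ω
      simp
    rw [hsub]
    exact eLpNorm_sub_le (hJ.sub hGA).aestronglyMeasurable (hJ.sub hI2).aestronglyMeasurable
      (by norm_num)
  rw [eLpNorm_eq_zero_iff (hI2.sub hGA).aestronglyMeasurable two_ne_zero] at hzero
  filter_upwards [hzero] with ω hω
  exact sub_eq_zero.1 hω

/-- The sets may overlap, so the summands need not be independent. Rewriting the combination as one
simple integral passes to disjoint level sets and makes it Gaussian. -/
lemma exists_simpleNoiseIntegral_eq_sum (hG : IsGaussianNoise G μ P) {ι : Type*} (S : Finset ι)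
    (c : ι → ℝ) (A : ι → Set E) (hA : ∀ i, MeasurableSet (A i)) (hμA : ∀ i, μ (A i) < ∞) :
    ∃ s : SimpleFunc E ℝ, MemLp s 2 μ ∧
      simpleNoiseIntegral G s =ᵐ[P] fun ω => ∑ i ∈ S, c i * G (A i) ω := by
  classical
  induction S using Finset.induction_on with
  | empty =>
    refine ⟨0, MemLp.zero, .of_forall fun ω => ?_⟩
    refine (Finset.sum_eq_zero fun x hx => ?_).trans Finset.sum_empty.symm
    obtain ⟨y, rfl⟩ := SimpleFunc.mem_range.1 hx
    simp
  | insert a S ha ih =>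
    obtain ⟨s, hs, hsS⟩ := ih
    have hmem := memLp_indicatorSimpleFunc (A a) (hA a) (hμA a)
    refine ⟨c a • indicatorSimpleFunc (A a) (hA a) + (1 : ℝ) • s,
      (hmem.const_smul (c a)).add (hs.const_smul 1), ?_⟩
    filter_upwards [hG.simpleNoiseIntegral_linear hmem hs (c a) 1, hsS,
      hG.simpleNoiseIntegral_indicatorSimpleFunc (hA a)] with ω h1 h2 h3
    rw [h1, h2, h3, Finset.sum_insert ha, one_mul]

/-- The restriction of a Gaussian noise to a family of sets of finite measure is a Gaussian
process. -/
lemma isGaussianProcess (hG : IsGaussianNoise G μ P) {T : Type*} (A : T → Set E)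
    (hA : ∀ t, MeasurableSet (A t)) (hμA : ∀ t, μ (A t) < ∞) :
    IsGaussianProcess (fun t => G (A t)) P where
  hasGaussianLaw I := by
    classical
    have hm : AEMeasurable (fun ω => I.restrict (fun t => G (A t) ω)) P :=
      aemeasurable_pi_lambda _ fun t => (hG.hasLaw (A t) (hA t) (hμA t)).aemeasurable
    -- Joint Gaussianity is tested on linear functionals, each of which is almost surely a simple
    -- integral.
    refine ⟨isGaussian_of_isGaussian_map fun L => ?_⟩
    rw [AEMeasurable.map_map_of_aemeasurable (by fun_prop) hm]
    obtain ⟨s, hs, hsum⟩ := hG.exists_simpleNoiseIntegral_eq_sum Finset.univ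
      (fun i : I => L (Pi.single i 1)) (fun i => A i) (fun i => hA i) (fun i => hμA i)
    refine ((hG.hasGaussianLaw_simpleNoiseIntegral hs).congr (hsum.trans ?_)).isGaussian_map
    refine .of_forall fun ω => ?_
    exact (StrongDual.apply_eq_sum_single L _).symm

/-- Split `G B` into `G A` and `G (B \ A)`; the second is independent of the first, leaving only the
variance of `G A`. -/
lemma covariance_of_subset (hG : IsGaussianNoise G μ P) {A B : Set E}
    (hA : MeasurableSet A) (hB : MeasurableSet B) (hμB : μ B < ∞) (hAB : A ⊆ B) :
    cov[G A, G B; P] = μ.real A := by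
  have hμA := (measure_mono hAB).trans_lt hμB
  have hμD := (measure_mono (Set.sdiff_subset (s := B) (t := A))).trans_lt hμB
  have hD := hB.diff hA
  have := (hG.hasGaussianLaw hA hμA).isProbabilityMeasure
  have hadd := hG.additive A (B \ A) hA hμA hD hμD Set.disjoint_sdiff_right
  rw [Set.union_sdiff_cancel hAB] at hadd
  have hind : IndepFun (G A) (G (B \ A)) P := by
    refine (hG.indep 2 ![A, B \ A] ?_ ?_).indepFun (i := 0) (j := 1) (by simp)
    · simp [Fin.forall_fin_two, hA, hD, hμA, hμD]
    · rintro i j hij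
      fin_cases i <;> fin_cases j
      · exact absurd rfl hij
      · exact Set.disjoint_sdiff_right
      · exact Set.disjoint_sdiff_left
      · exact absurd rfl hij
  have mA := (hG.hasGaussianLaw hA hμA).memLp_two
  have mD := (hG.hasGaussianLaw hD hμD).memLp_two
  have hcongr : cov[G A, G B; P] = cov[G A, G A + G (B \ A); P] := by
    rw [covariance, covariance, integral_congr_ae hadd]
    refine integral_congr_ae ?_
    filter_upwards [hadd] with ω hω
    rw [hω]
  rw [hcongr, covariance_add_right mA mA mD, hind.covariance_eq_zero mA mD, add_zero,
    covariance_self mA.aemeasurable, hG.variance_eq hA hμA]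

end IsGaussianNoise

/-! ### Equality in law of Gaussian processes. -/

lemma StrongDual.comp_restrict_eq_sum {T Ω : Type*} [DecidableEq T] {I : Finset T}
    (L : StrongDual ℝ (I → ℝ)) (X : T → Ω → ℝ) : (L ∘ fun ω => I.restrict (X · ω)) =
      fun ω => ∑ i : I, L (Pi.single i 1) * X i ω :=
  funext fun _ => StrongDual.apply_eq_sum_single L _

lemma StrongDual.integral_comp_restrict {T Ω : Type*} [DecidableEq T] [MeasurableSpace Ω]
    {P : Measure Ω} {I : Finset T} (L : StrongDual ℝ (I → ℝ)) {X : T → Ω → ℝ}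
    (hX : ∀ t, Integrable (X t) P) : ∫ ω, (L ∘ fun ω => I.restrict (X · ω)) ω ∂P =
      ∑ i : I, L (Pi.single i 1) * ∫ ω, X i ω ∂P := by
  rw [StrongDual.comp_restrict_eq_sum, integral_finsetSum Finset.univ
    (f := fun (i : I) ω => L (Pi.single i 1) * X i ω) fun i _ => (hX i).const_mul _]
  simp_rw [integral_const_mul]

lemma StrongDual.variance_comp_restrict {T Ω : Type*} [DecidableEq T] [MeasurableSpace Ω]
    {P : Measure Ω} [IsFiniteMeasure P] {I : Finset T} (L : StrongDual ℝ (I → ℝ)) {X : T → Ω → ℝ}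
    (hX : ∀ t, MemLp (X t) 2 P) : Var[L ∘ fun ω => I.restrict (X · ω); P] =
      ∑ i : I, ∑ j : I,
        L (Pi.single i 1) * (L (Pi.single j 1) * cov[X i, X j; P]) := by
  rw [StrongDual.comp_restrict_eq_sum, variance_fun_sum' (s := Finset.univ)
    (X := fun (i : I) ω => L (Pi.single i 1) * X i ω) fun i _ => (hX i).const_mul _]
  simp_rw [covariance_const_mul_left, covariance_const_mul_right]

/-- The characteristic function of a Gaussian vector depends only on the mean and variance of each
linear functional, and these are determined by the means and covariances of the coordinates. -/
lemma ProbabilityTheory.IsGaussianProcess.equalInLaw {T Ω Ω' : Type*} [MeasurableSpace Ω]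
    [MeasurableSpace Ω'] {P : Measure Ω} {P' : Measure Ω'} {X : T → Ω → ℝ} {X' : T → Ω' → ℝ}
    (hX : IsGaussianProcess X P) (hX' : IsGaussianProcess X' P')
    (hmean : ∀ t, ∫ ω, X t ω ∂P = ∫ ω, X' t ω ∂P')
    (hcov : ∀ s t, cov[X s, X t; P] = cov[X' s, X' t; P']) : EqualInLaw X P X' P' := by
  have := hX.isProbabilityMeasure
  have := hX'.isProbabilityMeasure
  classical
  intro I
  have hI := hX.hasGaussianLaw I
  have hI' := hX'.hasGaussianLaw I
  refine ⟨hI.aemeasurable, hI'.aemeasurable, ?_⟩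
  have := hI.isGaussian_map
  have := hI'.isGaussian_map
  refine Measure.ext_of_charFunDual (funext fun L => ?_)
  rw [hI.charFunDual_map_eq, hI'.charFunDual_map_eq]
  have e1 : Var[L ∘ fun ω => I.restrict (X · ω); P] =
      Var[L ∘ fun ω => I.restrict (X' · ω); P'] := by
    rw [StrongDual.variance_comp_restrict L fun i => (hX.hasGaussianLaw_eval i).memLp_two,
      StrongDual.variance_comp_restrict L fun i => (hX'.hasGaussianLaw_eval i).memLp_two]
    simp_rw [hcov]
  have e2 : ∫ ω, (L ∘ fun ω => I.restrict (X · ω)) ω ∂P =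
      ∫ ω, (L ∘ fun ω => I.restrict (X' · ω)) ω ∂P' := by
    rw [StrongDual.integral_comp_restrict L fun i => (hX.hasGaussianLaw_eval i).integrable,
      StrongDual.integral_comp_restrict L fun i => (hX'.hasGaussianLaw_eval i).integrable]
    simp_rw [hmean]
  rw [e1]
  congr 3
  simpa only [integral_complex_ofReal, Complex.ofReal_inj] using e2

/-- A Gaussian noise along an increasing family of sets is a time-changed Brownian motion. -/
lemma IsGaussianNoise.equalInLaw_of_monotone {E Ω Ω' : Type*} [MeasurableSpace E]
    [MeasurableSpace Ω] [MeasurableSpace Ω'] {G : Set E → Ω → ℝ} {μ : Measure E} {P : Measure Ω}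
    (hG : IsGaussianNoise G μ P) {T : Type*} [LinearOrder T] {A : T → Set E}
    (hA : ∀ t, MeasurableSet (A t)) (hmono : Monotone A) {v : T → ℝ≥0} (hv : ∀ t, μ (A t) = v t)
    {Y : T → Ω → ℝ} (hY : ∀ t, IsNoiseIntegral G μ P ((A t).indicator 1) (Y t))
    {P' : Measure Ω'} {B : ℝ≥0 → Ω' → ℝ} (hB : IsPreBrownianReal B P') :
    EqualInLaw Y P (fun t => B (v t)) P' := by
  have hμA : ∀ t, μ (A t) < ∞ := fun t => hv t ▸ ENNReal.coe_lt_top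
  have hYG : ∀ t, Y t =ᵐ[P] G (A t) := fun t =>
    hG.ae_eq_of_isNoiseIntegral_indicator (hA t) (hμA t) (hY t)
  have hlaw : EqualInLaw (fun t => G (A t)) P (fun t => B (v t)) P' := by
    refine (hG.isGaussianProcess A hA hμA).equalInLaw
      (hB.isGaussianProcess.comp_right v) (fun t => ?_) fun s t => ?_
    · rw [hG.integral_eq_zero (hA t) (hμA t), hB.integral_eval]
    · have hvm : Monotone v := fun s t hst => by
        rw [← ENNReal.coe_le_coe, ← hv, ← hv]
        exact measure_mono (hmono hst)
      rw [hB.covariance_eval]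
      wlog hst : s ≤ t generalizing s t
      · rw [covariance_comm, this t s (le_of_not_ge hst), min_comm]
      rw [hG.covariance_of_subset (hA s) (hA t) (hμA t) (hmono hst), min_eq_left (hvm hst),
        measureReal_def, hv]
      rfl
  intro I
  refine (IdentDistrib.of_ae_eq ?_ ?_).trans (hlaw I)
  · exact aemeasurable_pi_lambda _ fun t =>
      ((hY t).2.1.aestronglyMeasurable.aemeasurable)
  · filter_upwards [ae_all_iff.2 fun t : I => hYG t] with ω hω
    exact funext hω

/-! ### Geometry of the ball conditions. -/

/-- With `z` a common point, write `x j = z + (x j - z)`: the set is the diagonal subspace plus a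
product of closed balls, a closed set plus a compact one. -/
lemma isClosed_setOf_closedBalls_meet {ι V : Type*} [Finite ι] [NormedAddCommGroup V]
    [NormedSpace ℝ V] [FiniteDimensional ℝ V] (t : ℝ) :
    IsClosed {x : ι → V | (⋂ j, Metric.closedBall (x j) t).Nonempty} := by
  have := Fintype.ofFinite ι
  have := FiniteDimensional.proper ℝ V
  have heq : {x : ι → V | (⋂ j, Metric.closedBall (x j) t).Nonempty} =
      ((LinearMap.range (LinearMap.pi fun _ : ι => (LinearMap.id : V →ₗ[ℝ] V)) :
        Submodule ℝ (ι → V)) : Set (ι → V)) + Set.univ.pi fun _ => Metric.closedBall 0 t := by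
    ext x
    simp only [Set.mem_ofPred_eq, Set.mem_add]
    constructor
    · rintro ⟨z, hz⟩
      refine ⟨fun _ => z, ⟨z, rfl⟩, fun j => x j - z, fun j _ => ?_, by ext; simp⟩
      rw [mem_closedBall_zero_iff, ← dist_eq_norm, dist_comm]
      exact Set.mem_iInter.1 hz j
    · rintro ⟨_, ⟨z, rfl⟩, u, hu, rfl⟩
      refine ⟨z, Set.mem_iInter.2 fun j => ?_⟩
      simpa using hu j trivial
  rw [heq]
  exact (Submodule.closed_of_finiteDimensional _).add_right_of_isCompact
    (isCompact_univ_pi fun _ => isCompact_closedBall 0 t)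

/-- The properties of `almostAllBallsMeet` and `allBallsMeet` as families of sets indexed by the
radius on which the law of the limit process depends. -/
structure IsRadiusFamily {ι V : Type*} [Fintype ι] [NormedAddCommGroup V] [NormedSpace ℝ V]
    (S : ℝ → Set (ι → V)) : Prop where
  isClosed : ∀ t, IsClosed (S t)
  mono : Monotone S
  smul_mem : ∀ ⦃r t : ℝ⦄, 0 < r → ∀ ⦃x⦄, x ∈ S t → r • x ∈ S (r * t)
  zero_mem : ∀ t, 0 ≤ t → 0 ∈ S t
  dist_le : ∀ ⦃t x⦄, x ∈ S t → ∀ i j, dist (x i) (x j) ≤ 2 * t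

lemma dist_le_of_closedBalls_meet {ι V : Type*} [NormedAddCommGroup V] {x : ι → V} {t : ℝ} {z : V}
    {i j : ι} (hi : z ∈ Metric.closedBall (x i) t) (hj : z ∈ Metric.closedBall (x j) t) :
    dist (x i) (x j) ≤ 2 * t := by
  rw [two_mul]
  exact (dist_triangle_left _ _ z).trans (add_le_add hi hj)

lemma smul_mem_closedBall_smul {V : Type*} [NormedAddCommGroup V] [NormedSpace ℝ V] {r t : ℝ}
    (hr : 0 < r) {x z : V} (hz : z ∈ Metric.closedBall x t) :
    r • z ∈ Metric.closedBall (r • x) (r * t) := by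
  rw [Metric.mem_closedBall, dist_smul₀, Real.norm_of_nonneg hr.le]
  exact mul_le_mul_of_nonneg_left hz hr.le

lemma isRadiusFamily_allBallsMeet (d m : ℕ) : IsRadiusFamily (allBallsMeet d m) where
  isClosed t := isClosed_setOf_closedBalls_meet t
  mono _ _ hst _ hx := hx.mono <| Set.iInter_mono
    fun _ => Metric.closedBall_subset_closedBall hst
  smul_mem r _ hr _ := fun ⟨z, hz⟩ => ⟨r • z, Set.mem_iInter.2 fun j =>
    smul_mem_closedBall_smul hr (Set.mem_iInter.1 hz j)⟩
  zero_mem _ ht := ⟨0, Set.mem_iInter.2 fun _ => Metric.mem_closedBall_self ht⟩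
  dist_le _ _ := fun ⟨_, hz⟩ i j =>
    dist_le_of_closedBalls_meet (Set.mem_iInter.1 hz i) (Set.mem_iInter.1 hz j)

/-- With three or more points, any two of them survive the omission of a third, so their balls meet
and the distance bound follows. For two points only single balls remain and no bound holds. -/
lemma isRadiusFamily_almostAllBallsMeet (d : ℕ) {m : ℕ} (hm : 3 ≤ m) :
    IsRadiusFamily (almostAllBallsMeet d m) where
  isClosed t := by
    have heq : almostAllBallsMeet d m t = ⋂ j₀ : Fin m,
        (fun (x : Fin m → EuclideanSpace ℝ (Fin d)) (j : {j // j ≠ j₀}) => x j) ⁻¹'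
          {x | (⋂ j, Metric.closedBall (x j) t).Nonempty} := by
      ext x
      simp only [almostAllBallsMeet, Set.mem_ofPred_eq, Set.mem_iInter, Set.mem_preimage,
        Set.iInter_subtype]
    rw [heq]
    exact isClosed_iInter fun j₀ => (isClosed_setOf_closedBalls_meet t).preimage
      (continuous_pi fun j => continuous_apply _)
  mono _ _ hst _ hx j₀ := (hx j₀).mono <| Set.iInter₂_mono
    fun _ _ => Metric.closedBall_subset_closedBall hst
  smul_mem r t hr x hx j₀ := by
    obtain ⟨z, hz⟩ := hx j₀
    exact ⟨r • z, Set.mem_iInter₂.2 fun j hj =>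
      smul_mem_closedBall_smul hr (Set.mem_iInter₂.1 hz j hj)⟩
  zero_mem t ht j₀ := ⟨0, Set.mem_iInter₂.2 fun _ _ => Metric.mem_closedBall_self ht⟩
  dist_le t x hx i j := by
    obtain ⟨j₀, hj₀⟩ : ∃ j₀, j₀ ∉ ({i, j} : Finset (Fin m)) := by
      by_contra! h
      have := Finset.card_le_card (fun a _ => h a : Finset.univ ⊆ ({i, j} : Finset (Fin m)))
      have := Finset.card_le_two (a := i) (b := j)
      rw [Finset.card_univ, Fintype.card_fin] at *
      omega
    rw [Finset.mem_insert, Finset.mem_singleton, not_or] at hj₀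
    obtain ⟨z, hz⟩ := hx j₀
    exact dist_le_of_closedBalls_meet (Set.mem_iInter₂.1 hz i (Ne.symm hj₀.1))
      (Set.mem_iInter₂.1 hz j (Ne.symm hj₀.2))

/-! ### Boundedness and scaling of the sections with first point at the origin. -/

namespace IsRadiusFamily

variable {n : ℕ} {V : Type*} [NormedAddCommGroup V] [NormedSpace ℝ V]
  {S : ℝ → Set (Fin (n + 1) → V)}

lemma isClosed_zero_section (hS : IsRadiusFamily S) (t : ℝ) :
    IsClosed {y : Fin n → V | (Fin.cons 0 y : Fin (n + 1) → V) ∈ S t} :=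
  (hS.isClosed t).preimage (by fun_prop)

lemma zero_section_subset_closedBall (hS : IsRadiusFamily S) {t : ℝ} (ht : 0 ≤ t) :
    {y : Fin n → V | (Fin.cons 0 y : Fin (n + 1) → V) ∈ S t} ⊆ Metric.closedBall 0 (2 * t) := by
  intro y hy
  rw [mem_closedBall_zero_iff, pi_norm_le_iff_of_nonneg (by positivity)]
  intro i
  simpa using hS.dist_le hy i.succ 0

lemma cons_zero_smul (r : ℝ) (y : Fin n → V) :
    (Fin.cons 0 (r • y) : Fin (n + 1) → V) = r • (Fin.cons 0 y : Fin (n + 1) → V) := by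
  ext i
  refine Fin.cases ?_ (fun i => ?_) i <;> simp

lemma zero_section_eq_smul (hS : IsRadiusFamily S) {t : ℝ} (ht : 0 ≤ t) :
    {y : Fin n → V | (Fin.cons 0 y : Fin (n + 1) → V) ∈ S t} =
      t • {y : Fin n → V | (Fin.cons 0 y : Fin (n + 1) → V) ∈ S 1} := by
  have h0 : ∀ s, 0 ≤ s → (Fin.cons 0 (0 : Fin n → V) : Fin (n + 1) → V) ∈ S s := fun s hs => by
    have : (Fin.cons 0 (0 : Fin n → V) : Fin (n + 1) → V) = 0 := by
      simpa using cons_zero_smul (0 : ℝ) (0 : Fin n → V)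
    rw [this]
    exact hS.zero_mem s hs
  -- At radius `0` dilation is not invertible; there the distance bound forces all points to
  -- coincide, and both sides are `{0}`.
  rcases ht.eq_or_lt with rfl | ht
  · rw [Set.zero_smul_set ⟨0, h0 1 zero_le_one⟩]
    refine Set.Subset.antisymm (fun y hy => ?_) ?_
    · simpa using hS.zero_section_subset_closedBall le_rfl hy
    · rintro _ rfl
      exact h0 0 le_rfl
  · ext y
    rw [Set.mem_smul_set_iff_inv_smul_mem₀ ht.ne', Set.mem_ofPred_eq, Set.mem_ofPred_eq,
      cons_zero_smul]
    constructor
    · intro hy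
      have := hS.smul_mem (inv_pos.2 ht) hy
      rwa [inv_mul_cancel₀ ht.ne'] at this
    · intro hy
      have := hS.smul_mem ht hy
      rwa [smul_inv_smul₀ ht.ne', mul_one] at this

end IsRadiusFamily

/-! ### The clock and the final identification. -/

/-- Ensures that `ENNReal.ofReal` in `controlMeasure` does not truncate the constant. -/
lemma constC_nonneg {d : ℕ} (k : ℕ) {α : ℝ} (hα : (d : ℝ) < α) : 0 ≤ constC d k α := by
  have hd : (0 : ℝ) ≤ d := d.cast_nonneg
  have hk : (0 : ℝ) ≤ k := k.cast_nonneg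
  have : (d : ℝ) ≤ α * ((k : ℝ) + 2) := by nlinarith
  exact div_nonneg measureReal_nonneg (mul_nonneg (by positivity) (sub_nonneg.2 this))

/-- The law of the noise integrals of the indicator functions of the zero sections of a
family of sets indexed by the radius. -/
lemma IsRadiusFamily.noiseIntegral_law {Ω Ω' : Type*} [MeasurableSpace Ω] [MeasurableSpace Ω']
    {d k : ℕ} {α : ℝ} (hα : (d : ℝ) < α) {P : Measure Ω}
    {G : Set (Fin (k + 1) → EuclideanSpace ℝ (Fin d)) → Ω → ℝ}
    (hG : IsGaussianNoise G (controlMeasure d k α) P)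
    {S : ℝ → Set (Fin (k + 2) → EuclideanSpace ℝ (Fin d))} (hS : IsRadiusFamily S)
    {h : ℝ → (Fin (k + 1) → EuclideanSpace ℝ (Fin d)) → ℝ}
    (hh : ∀ t y, h t y = (S t).indicator 1 (Fin.cons 0 y)) :
    Integrable (h 1) ∧
      (∀ t : ℝ≥0, ∃ I, IsNoiseIntegral G (controlMeasure d k α) P (h t) I) ∧
      ∀ Y : ℝ≥0 → Ω → ℝ,
        (∀ t : ℝ≥0, IsNoiseIntegral G (controlMeasure d k α) P (h t) (Y t)) →
        ∀ (P' : Measure Ω') (B : ℝ≥0 → Ω' → ℝ), IsPreBrownianReal B P' →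
          EqualInLaw Y P
            (fun t => B ((constC d k α * ∫ y, h 1 y) * (t : ℝ) ^ (d * (k + 1))).toNNReal) P' := by
  let A : ℝ≥0 → Set (Fin (k + 1) → EuclideanSpace ℝ (Fin d)) :=
    fun t => {y | (Fin.cons 0 y : Fin (k + 2) → EuclideanSpace ℝ (Fin d)) ∈ S t}
  have hhA : ∀ t : ℝ≥0, h t = (A t).indicator 1 := fun t => by
    ext y
    rw [hh]
    rfl
  have hA : ∀ t, MeasurableSet (A t) := fun t => (hS.isClosed_zero_section t).measurableSet
  have hvol : ∀ t, volume (A t) < ∞ := fun t =>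
    (measure_mono (hS.zero_section_subset_closedBall t.2)).trans_lt measure_closedBall_lt_top
  have hint : ∫ y, h 1 y = volume.real (A 1) := by
    rw [← NNReal.coe_one, hhA, integral_indicator_one (hA 1)]
  have hscale : ∀ t : ℝ≥0, volume (A t) =
      ENNReal.ofReal ((t : ℝ) ^ (d * (k + 1))) * volume (A 1) := fun t => by
    have hdim : Module.finrank ℝ (Fin (k + 1) → EuclideanSpace ℝ (Fin d)) = d * (k + 1) := by
      rw [Module.finrank_pi_fintype]
      simp [mul_comm]
    have hAt : A t = (t : ℝ) • A 1 := hS.zero_section_eq_smul t.2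
    rw [hAt, Measure.addHaar_smul, hdim, abs_of_nonneg (by positivity)]
  have hv : ∀ t : ℝ≥0, controlMeasure d k α (A t) =
      ((constC d k α * ∫ y, h 1 y) * (t : ℝ) ^ (d * (k + 1))).toNNReal := fun t => by
    rw [controlMeasure, Measure.smul_apply, smul_eq_mul, hscale, hint, mul_right_comm]
    -- The coercion of `Real.toNNReal` to `ℝ≥0∞` is `ENNReal.ofReal` by definition.
    change _ = ENNReal.ofReal _
    rw [ENNReal.ofReal_mul (mul_nonneg (constC_nonneg k hα) (by positivity)),
      ENNReal.ofReal_mul (constC_nonneg k hα), ofReal_measureReal (hvol 1).ne, mul_assoc]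
  have hμA : ∀ t, controlMeasure d k α (A t) < ∞ := fun t => hv t ▸ ENNReal.coe_lt_top
  have hmono : Monotone A := fun s t hst y hy => hS.mono (NNReal.coe_le_coe.2 hst) hy
  refine ⟨?_, fun t => ⟨G (A t), hhA t ▸ hG.isNoiseIntegral_indicator (hA t) (hμA t)⟩,
    fun Y hY P' B hB => hG.equalInLaw_of_monotone hA hmono hv (fun t => hhA t ▸ hY t) hB⟩
  rw [← NNReal.coe_one, hhA]
  exact (integrable_indicator_iff (hA 1)).2 (integrableOn_const (hvol 1).ne)

theorem mainTheorem5 {Ω Ω' : Type*} [MeasurableSpace Ω] [MeasurableSpace Ω']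
    (d k : ℕ) (hd : 1 ≤ d) (hk : 1 ≤ k) (α : ℝ) (hα : (d : ℝ) < α)
    (P : Measure Ω) [IsProbabilityMeasure P]
    (G : Set (Fin (k + 1) → EuclideanSpace ℝ (Fin d)) → Ω → ℝ)
    (hG : IsGaussianNoise G (controlMeasure d k α) P) :
    (Integrable (hPlusZero d k 1) ∧
      (∀ t : ℝ≥0, ∃ I, IsNoiseIntegral G (controlMeasure d k α) P (hPlusZero d k t) I) ∧
      ∀ Y : ℝ≥0 → Ω → ℝ,
        (∀ t : ℝ≥0, IsNoiseIntegral G (controlMeasure d k α) P (hPlusZero d k t) (Y t)) →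
        ∀ (P' : Measure Ω') [IsProbabilityMeasure P'] (B : ℝ≥0 → Ω' → ℝ), IsBrownianReal B P' →
          EqualInLaw Y P
            (fun t => B (constDPlus d k α * (t : ℝ) ^ (d * (k + 1))).toNNReal) P') ∧
    (Integrable (hMinusZero d k 1) ∧
      (∀ t : ℝ≥0, ∃ I, IsNoiseIntegral G (controlMeasure d k α) P (hMinusZero d k t) I) ∧
      ∀ Y : ℝ≥0 → Ω → ℝ,
        (∀ t : ℝ≥0, IsNoiseIntegral G (controlMeasure d k α) P (hMinusZero d k t) (Y t)) →
        ∀ (P' : Measure Ω') [IsProbabilityMeasure P'] (B : ℝ≥0 → Ω' → ℝ), IsBrownianReal B P' →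
          EqualInLaw Y P
            (fun t => B (constDMinus d k α * (t : ℝ) ^ (d * (k + 1))).toNNReal) P') := by
  -- The bound `3 ≤ k + 2` is where `1 ≤ k` enters; it keeps the support of `h⁺(0, ·)` bounded.
  obtain ⟨h1, h2, h3⟩ := (isRadiusFamily_almostAllBallsMeet d (m := k + 2) (by omega)
    ).noiseIntegral_law (Ω' := Ω') hα hG (h := hPlusZero d k) fun _ _ => rfl
  obtain ⟨h4, h5, h6⟩ := (isRadiusFamily_allBallsMeet d (k + 2)
    ).noiseIntegral_law (Ω' := Ω') hα hG (h := hMinusZero d k) fun _ _ => rfl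
  exact ⟨⟨h1, h2, fun Y hY P' _ B hB => h3 Y hY P' B hB.toIsPreBrownianReal⟩,
    ⟨h4, h5, fun Y hY P' _ B hB => h6 Y hY P' B hB.toIsPreBrownianReal⟩⟩
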